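/- Let $k$ be a field of characteristic $p>0$, let $P$ be a finite poset, and let $J(P)$ be the set of its poset ideals (subsets closed downwards, including $\emptyset$). The Hibi ring is the subalgebra $$R=k\Big[\,T\prod_{x\in I}X_x \;\Big|\; I\in J(P)\Big]\subseteq k[T,X_x \mid x\in P],$$ graded by the degree in $T$, and $\mathfrak m=R_+$ is its graded maximal ideal, generated by the monomials $T\prod_{x\in I}X_x$. For a real number $t\ge 0$, the pair $(R,\mathfrak m^t)$ is called F-pure if for all large $q=p^e$ there is $d\in\mathfrak m^{\lceil t(q-1)\rceil}$ such that the $R$-linear map $R\to R^{1/q}$, $1\mapsto d^{1/q}$, splits; and $\operatorname{fpt}(\mathfrak m)=\sup\{t\ge 0\mid (R,\mathfrak m^t)\text{ is F-pure}\}$. Write $x\lessdot y$ if $y$ covers $x$. A path in a finite poset $Q$ is a sequence $C=(q_1,\dots,q_t)$, $t\ge 1$, of distinct elements such that $q_1$ is minimal, $q_i\lessdot q_{i+1}$ or $q_{i+1}\lessdot q_i$ for all $i<t$, and $q_{t-1}\lessdot q_t$ if $t\ge 2$. It is maximal if $q_t$ is a maximal element of $Q$. Its upper length $\operatorname{len}^*C$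 is the number of $i<t$ with $q_i\lessdot q_{i+1}$. Call $q_i$ locally maximal in $C$ if $i=t$, or if $1<i<t$, $q_{i-1}\lessdot q_i$ and $q_{i+1}\lessdot q_i$; call it locally minimal in $C$ if $i=1$, or if $1<i<t$, $q_i\lessdot q_{i-1}$ and $q_i\lessdot q_{i+1}$. Cut $C$ just after each locally maximal $q_i$ with $i<t$ and just after each locally minimal $q_i$ with $i>1$; this gives a decomposition $C=A_1+D_1+A_2+\dots+D_{n-1}+A_n$ into consecutive blocks, where each $A_i$ is an ascending chain ending with a locally maximal element $t(A_i)$ and each $D_i$ is a descending chain ending with a locally minimal element. For $S\subseteq Q$ let $\langle S\rangle$ be the poset ideal generated by $S$. The path $C$ satisfies condition $(*)$ if for all $1\le i\le n-1$ 1. $D_i\cap\big(\bigcup_{m=1}^{i-1}\langle A_m\rangle\cup\langle A_i\setminus\{t(A_i)\}\rangle\cup\{t(A_i)\}\big)=\emptyset$, and 2. $A_{i+1}\cap\bigcup_{m=1}^{i}\langle A_m\rangle=\emptyset$. The lower rank of $Q$ is $\operatorname{rank}_*Q=\min\{\operatorname{len}^*C\mid C\text{ is a maximal path of }Q\text{ satisfying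 }(*)\}$. Let $\overline P=P\cup\{-\infty,\infty\}$ be $P$ with a new least and a new greatest element adjoined. **Theorem.** We have $\operatorname{fpt}(\mathfrak m)=\operatorname{rank}_*\overline P$, and if $P\neq\emptyset$, then $\operatorname{rank}_*\overline P=\operatorname{rank}_*P+2$. In particular, $\operatorname{fpt}(\mathfrak m)\in\mathbb N$. -/

import Mathlib

open scoped NNReal ENNReal

/-! ### Paths in the Hasse diagram of a poset, condition (*) and the lower rank -/

/-- A path `(q 0, q 1, …, q n)` in the Hasse diagram of `P`: distinct elements, consecutive ones
related by a covering relation, starting at a minimal element, whose last step (if there is one)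
ascends. Only the values `q 0, …, q n` are part of the path; the values of `q` beyond `n` are
irrelevant and never used. -/
structure HassePath (P : Type*) [PartialOrder P] where
  n : ℕ
  q : ℕ → P
  distinct : Set.InjOn q (Set.Iic n)
  isMin_first : IsMin (q 0)
  last_ascends : ∀ i, i + 1 = n → q i ⋖ q (i + 1)
  step : ∀ i < n, q i ⋖ q (i + 1) ∨ q (i + 1) ⋖ q i

namespace HassePath

variable {P : Type*} [PartialOrder P]

/-- A path is maximal if it ends at a maximal element of the poset. -/
def IsMaximalPath (C : HassePath P) : Prop := IsMax (C.q C.n)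

/-- The upper length: the number of ascending edges. -/
noncomputable def upperLength (C : HassePath P) : ℕ :=
  Set.ncard {i : ℕ | i < C.n ∧ C.q i ⋖ C.q (i + 1)}

/-- Position `i` carries a locally maximal element of the path. By convention the last element of
the path is locally maximal (and the first one counts as locally minimal). -/
def IsLocMax (C : HassePath P) (i : ℕ) : Prop :=
  i = C.n ∨ (0 < i ∧ i < C.n ∧ C.q (i - 1) ⋖ C.q i ∧ C.q (i + 1) ⋖ C.q i)

/-- The number of locally maximal positions strictly before position `j`. -/
noncomputable def locMaxBefore (C : HassePath P) (j : ℕ) : ℕ :=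
  Set.ncard {i : ℕ | i < j ∧ C.IsLocMax i}

/-- The number `N` of ascending chains in the decomposition
`C = A₁ + D₁ + A₂ + ⋯ + D_{N-1} + A_N`; each of them ends at a locally maximal element. -/
noncomputable def numAsc (C : HassePath P) : ℕ :=
  Set.ncard {i : ℕ | C.IsLocMax i}

/-- The vertex set `V(A_m)`, `m ≥ 1`, of the `m`-th ascending chain of the decomposition. It
consists of the vertices that are reached by an ascending edge (or are the first vertex) and have
exactly `m - 1` locally maximal elements before them. So `A_m` ends with a locally maximal element
and, for `m ≥ 2`, begins just after a locally minimal one. -/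
def asc (C : HassePath P) (m : ℕ) : Set P :=
  {x | ∃ j ≤ C.n, (j = 0 ∨ C.q (j - 1) ⋖ C.q j) ∧ C.locMaxBefore j + 1 = m ∧ C.q j = x}

/-- The vertex set `V(D_m)`, `m ≥ 1`, of the `m`-th descending chain of the decomposition. It
consists of the vertices that are reached by a descending edge and have exactly `m` locally
maximal elements before them. So `D_m` begins just after the locally maximal element that ends
`A_m` and ends with a locally minimal element. -/
def desc (C : HassePath P) (m : ℕ) : Set P :=
  {x | ∃ j ≤ C.n, 0 < j ∧ C.q j ⋖ C.q (j - 1) ∧ C.locMaxBefore j = m ∧ C.q j = x}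

/-- The singleton `{t(A_m)}`, where `t(A_m)` is the largest element of the chain `A_m`. -/
def ascTop (C : HassePath P) (m : ℕ) : Set P := {x | IsGreatest (C.asc m) x}

/-- Condition (*), where `lowerClosure S` is the poset ideal generated by `S`. -/
def SatisfiesStar (C : HassePath P) : Prop :=
  ∀ i, 1 ≤ i → i < C.numAsc →
    Disjoint (C.desc i)
      ((⋃ m ∈ Set.Ico 1 i, (lowerClosure (C.asc m) : Set P)) ∪
        (lowerClosure (C.asc i \ C.ascTop i) : Set P) ∪ C.ascTop i) ∧
    Disjoint (C.asc (i + 1)) (⋃ m ∈ Set.Icc 1 i, (lowerClosure (C.asc m) : Set P))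

end HassePath

/-- The lower rank: the minimum of the upper lengths of the maximal paths satisfying (*). It is
taken in `ℕ∞`, so that it is finite exactly if there is such a path, and then it is a minimum. -/
noncomputable def lowerRank (P : Type*) [PartialOrder P] : ℕ∞ :=
  sInf {l : ℕ∞ | ∃ C : HassePath P, C.IsMaximalPath ∧ C.SatisfiesStar ∧ l = (C.upperLength : ℕ∞)}

/-- The poset `P` with a new least and a new greatest element adjoined. -/
abbrev ExtendedPoset (P : Type*) : Type _ := WithBot (WithTop P)

/-! ### Hibi rings -/

section Hibi

variable (k : Type*) [Field k] (P : Type*) [PartialOrder P] [Fintype P]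

open Classical in
/-- The monomial `T * ∏_{p ∈ I} X_p` of a poset ideal `I` in the polynomial ring with the
variables `T = X none` and `X_p = X (some p)`. -/
noncomputable def hibiMonomial (I : LowerSet P) : MvPolynomial (Option P) k :=
  MvPolynomial.X none * ∏ p ∈ Finset.univ.filter (fun p : P => p ∈ I), MvPolynomial.X (some p)

/-- The Hibi ring of the distributive lattice `J(P)` of poset ideals of `P` over `k`. -/
noncomputable def hibiRing : Subalgebra k (MvPolynomial (Option P) k) :=
  Algebra.adjoin k (Set.range (hibiMonomial k P))

/-- The generators of the Hibi ring, as elements of it. -/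
noncomputable def hibiGen (I : LowerSet P) : hibiRing k P :=
  ⟨hibiMonomial k P I, Algebra.subset_adjoin ⟨I, rfl⟩⟩

/-- The graded maximal ideal `R₊` of the Hibi ring `R`, which is standard graded by the degree in
`T`: it is generated by the generators of degree one. -/
noncomputable def hibiMaxIdeal : Ideal (hibiRing k P) :=
  Ideal.span (Set.range (hibiGen k P))

instance hibiRing_charP (p : ℕ) [CharP k p] : CharP (hibiRing k P) p :=
  charP_of_injective_algebraMap (algebraMap k (hibiRing k P)).injective p

end Hibi

/-! ### The F-pure threshold -/

/-- The `R`-module `R^{1/q}`, `q = p ^ e`, in the form `Fᵉ_* R`: the elements are those of `R`,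
where `x` stands for `x^{1/q}`, and `r : R` acts by `r • x^{1/q} = (r ^ q * x)^{1/q}`. -/
def FrobeniusRoot (R : Type*) (_p _e : ℕ) : Type _ := R

section FThreshold

variable {R : Type*} [CommRing R] (p : ℕ) [Fact p.Prime] [CharP R p]

instance (e : ℕ) : AddCommGroup (FrobeniusRoot R p e) := inferInstanceAs (AddCommGroup R)

instance (e : ℕ) : Module R (FrobeniusRoot R p e) :=
  Module.compHom R (iterateFrobenius R p e)

/-- The element `d^{1/q}` of `R^{1/q}`, `q = p ^ e`. -/
def frobeniusRoot (e : ℕ) (d : R) : FrobeniusRoot R p e := d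

theorem smul_frobeniusRoot (e : ℕ) (r d : R) :
    r • frobeniusRoot p e d = frobeniusRoot p e (r ^ p ^ e * d) := rfl

/-- The `R`-linear map `R → R^{1/q}`, `1 ↦ d^{1/q}`, splits. -/
def RootMapSplits (e : ℕ) (d : R) : Prop :=
  ∃ f : FrobeniusRoot R p e →ₗ[R] R,
    f ∘ₗ LinearMap.toSpanSingleton R (FrobeniusRoot R p e) (frobeniusRoot p e d) = LinearMap.id

/-- The pair `(R, 𝔞^t)` is F-pure: for all large `q = p ^ e` there is `d ∈ 𝔞^⌈t(q-1)⌉` such that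
the map `R → R^{1/q}`, `1 ↦ d^{1/q}`, splits. -/
def IsFPurePair (a : Ideal R) (t : ℝ≥0) : Prop :=
  ∀ᶠ e : ℕ in Filter.atTop, ∃ d ∈ a ^ ⌈(t : ℝ) * ((p : ℝ) ^ e - 1)⌉₊, RootMapSplits p e d

/-- The F-pure threshold `sup {t ≥ 0 | (R, 𝔞^t) is F-pure}`, as a supremum in `[0, ∞]`. -/
noncomputable def fpt (a : Ideal R) : ℝ≥0∞ :=
  sSup {s : ℝ≥0∞ | ∃ t : ℝ≥0, IsFPurePair p a t ∧ s = (t : ℝ≥0∞)}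

end FThreshold

/-!
A monomial of the Hibi ring is an antitone function `w` on the extended poset with `w ⊤ = 0`, and
its `T`-degree is `w ⊥`. The map `1 ↦ x ^ (w / q)` splits if and only if `w` drops by less than `q`
along every covering relation. Comparing `w` along a walk in the Hasse diagram, where descending
edges cost nothing, shows that the largest `T`-degree of such a `w` is `q - 1` times the least
number of ascents of a walk from `⊥` to `⊤`; so this number is the F-pure threshold.

It is also the lower rank. Call a walk tight if each edge realizes the distance to the maximal
elements, measured in ascents. On a tight walk this distance strictly decreases past every ascent,
whereas it is antitone on the poset, so no vertex lies below an earlier one from which it is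
separated by an ascent. This gives both the distinctness of the vertices and condition (*).
-/

theorem antitone_of_forall_covBy {α β : Type*} [PartialOrder α] [Finite α] [Preorder β]
    {f : α → β} (h : ∀ x y, x ⋖ y → f y ≤ f x) : Antitone f := by
  let _ : LocallyFiniteOrder α := .ofFiniteIcc fun a b ↦ (Set.Icc a b).toFinite
  exact (antitone_iff_forall_covBy f).2 h

/-! ### Tight sequences -/

section Tight

variable {Q : Type*} [PartialOrder Q]

/-- An edge of the Hasse diagram, traversed from `x` to `y`, along which the potential `d` drops by
exactly one if the edge ascends and is constant if it descends. -/
def TightStep (d : Q → ℕ) (x y : Q) : Prop :=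
  (x ⋖ y ∧ d x = d y + 1) ∨ (y ⋖ x ∧ d x = d y)

/-- A walk `q 0, …, q n` in the Hasse diagram whose steps are all tight for the potential `d`. As
for `HassePath`, the values of `q` beyond `n` are irrelevant. -/
def IsTight (d : Q → ℕ) (q : ℕ → Q) (n : ℕ) : Prop :=
  ∀ i < n, TightStep d (q i) (q (i + 1))

variable {d : Q → ℕ}

namespace TightStep

variable {x y : Q}

theorem covBy_or_covBy (h : TightStep d x y) : x ⋖ y ∨ y ⋖ x := h.imp And.left And.left

theorem eq_add_one (h : TightStep d x y) (hxy : x ⋖ y) : d x = d y + 1 :=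
  h.elim And.right fun h' ↦ absurd hxy.lt h'.1.lt.not_gt

theorem eq_of_not_covBy (h : TightStep d x y) (hxy : ¬ x ⋖ y) : d x = d y :=
  h.elim (fun h' ↦ absurd h'.1 hxy) And.right

theorem le (h : TightStep d x y) : d y ≤ d x := by
  rcases h with ⟨-, h⟩ | ⟨-, h⟩ <;> omega

end TightStep

namespace IsTight

variable {q : ℕ → Q} {n a b i : ℕ}

theorem le (hq : IsTight d q n) (hab : a ≤ b) (hb : b ≤ n) : d (q b) ≤ d (q a) := by
  induction b, hab using Nat.le_induction with
  | base => exact le_rfl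
  | succ b _ ih => exact (hq b (by omega)).le.trans (ih (by omega))

theorem lt_of_ascent (hq : IsTight d q n) (hai : a ≤ i) (hib : i < b) (hb : b ≤ n)
    (hi : q i ⋖ q (i + 1)) : d (q b) < d (q a) := by
  have hdrop := (hq i (by omega)).eq_add_one hi
  have hbefore := hq.le hai (by omega)
  have hafter := hq.le (show i + 1 ≤ b from hib) hb
  omega

theorem not_le_of_ascent (hd : Antitone d) (hq : IsTight d q n) (hai : a ≤ i) (hib : i < b)
    (hb : b ≤ n) (hi : q i ⋖ q (i + 1)) : ¬ q b ≤ q a := fun h ↦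
  (hd h).not_gt (hq.lt_of_ascent hai hib hb hi)

theorem lt_of_le (hq : IsTight d q n) (hab : a < b) (hb : b ≤ n) (h : d (q a) ≤ d (q b)) :
    q b < q a := by
  have hdesc : ∀ i, a ≤ i → i < b → q (i + 1) < q i := fun i hai hib ↦
    ((hq i (by omega)).covBy_or_covBy.resolve_left fun hi ↦
      h.not_gt (hq.lt_of_ascent hai hib hb hi)).lt
  clear h
  induction b, hab using Nat.le_induction with
  | base => exact hdesc a le_rfl (Nat.lt_succ_self a)
  | succ b hab ih =>
    exact (hdesc b (by omega) (by omega)).trans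
      (ih (by omega) fun i hai hib ↦ hdesc i hai (by omega))

theorem injOn (hq : IsTight d q n) : Set.InjOn q (Set.Iic n) := by
  intro a ha b hb hab
  rcases lt_trichotomy a b with h | h | h
  · exact absurd hab.symm (hq.lt_of_le h hb (by rw [hab])).ne
  · exact h
  · exact absurd hab (hq.lt_of_le h ha (by rw [hab])).ne

open Classical in
theorem eq_add_count (hq : IsTight d q n) :
    d (q 0) = d (q n) + Nat.count (fun i ↦ q i ⋖ q (i + 1)) n := by
  induction n with
  | zero => simp
  | succ n ih =>
    have hlast := hq n (by omega)
    rw [ih fun i hi ↦ hq i (by omega), Nat.count_succ]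
    split_ifs with h
    · rw [hlast.eq_add_one h]
      omega
    · rw [hlast.eq_of_not_covBy h]
      rfl

end IsTight

end Tight

/-! ### Condition (*) for tight paths -/

open Classical in
theorem ncard_lt_and_eq_count (s : ℕ → Prop) (n : ℕ) :
    Set.ncard {i : ℕ | i < n ∧ s i} = Nat.count s n := by
  rw [Nat.count_eq_card_filter_range, ← Set.ncard_coe_finset]
  simp

namespace HassePath

variable {Q : Type*} [PartialOrder Q] (C : HassePath Q)

open Classical in
theorem upperLength_eq_count :
    C.upperLength = Nat.count (fun i ↦ C.q i ⋖ C.q (i + 1)) C.n :=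
  ncard_lt_and_eq_count _ _

open Classical in
theorem locMaxBefore_eq_count (j : ℕ) : C.locMaxBefore j = Nat.count C.IsLocMax j :=
  ncard_lt_and_eq_count _ _

theorem lt_of_locMaxBefore_lt {a b : ℕ} (h : C.locMaxBefore a < C.locMaxBefore b) : a < b := by
  classical
  exact Nat.lt_of_count_lt_count (by simpa only [locMaxBefore_eq_count] using h)

theorem locMaxBefore_lt_of_isLocMax {a b : ℕ} (ha : C.IsLocMax a) (hab : a < b) :
    C.locMaxBefore a < C.locMaxBefore b := by
  classical
  simpa only [locMaxBefore_eq_count] using Nat.count_strict_mono ha hab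

theorem locMaxBefore_succ_le (a : ℕ) : C.locMaxBefore (a + 1) ≤ C.locMaxBefore a + 1 := by
  classical
  rw [locMaxBefore_eq_count, locMaxBefore_eq_count, Nat.count_succ]
  split_ifs <;> omega

theorem locMaxBefore_succ_of_not_isLocMax {j : ℕ} (h : ¬ C.IsLocMax j) :
    C.locMaxBefore (j + 1) = C.locMaxBefore j := by
  classical
  rw [locMaxBefore_eq_count, locMaxBefore_eq_count, Nat.count_succ_eq_count_iff.2 h]

theorem exists_ascent_of_locMaxBefore_lt {a b : ℕ} (hb : b ≤ C.n)
    (h : C.locMaxBefore (a + 1) < C.locMaxBefore b) :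
    ∃ i, a ≤ i ∧ i < b ∧ C.q i ⋖ C.q (i + 1) := by
  classical
  rw [locMaxBefore_eq_count, locMaxBefore_eq_count] at h
  obtain ⟨m, ⟨ham, hmb⟩, hm⟩ := Nat.exists_of_count_lt_count h
  obtain ⟨-, -, hasc, -⟩ := hm.resolve_left (by omega)
  exact ⟨m - 1, by omega, by omega, by rwa [Nat.sub_add_cancel (by omega)]⟩

theorem covBy_succ_of_not_isLocMax {b : ℕ} (hb : b < C.n) (hasc : b = 0 ∨ C.q (b - 1) ⋖ C.q b)
    (hm : ¬ C.IsLocMax b) : C.q b ⋖ C.q (b + 1) := by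
  refine (C.step b hb).resolve_right fun hdesc ↦ ?_
  obtain rfl | hpos := Nat.eq_zero_or_pos b
  · exact hdesc.lt.not_ge (C.isMin_first hdesc.le)
  · exact hm (.inr ⟨hpos, hb, hasc.resolve_left hpos.ne', hdesc⟩)

theorem le_of_locMaxBefore_eq {a b : ℕ} (hab : a ≤ b) (hb : b ≤ C.n)
    (ha : a = 0 ∨ C.q (a - 1) ⋖ C.q a) (h : C.locMaxBefore a = C.locMaxBefore b) :
    C.q a ≤ C.q b := by
  have hup : ∀ j, a ≤ j → j < b → (j = 0 ∨ C.q (j - 1) ⋖ C.q j) → C.q j ⋖ C.q (j + 1) :=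
    fun j haj hjb hj ↦ C.covBy_succ_of_not_isLocMax (by omega) hj fun hm ↦ by
      have hlt := C.locMaxBefore_lt_of_isLocMax hm hjb
      have := mt C.lt_of_locMaxBefore_lt (show ¬ j < a by omega)
      omega
  suffices C.q a ≤ C.q b ∧ (b = 0 ∨ C.q (b - 1) ⋖ C.q b) from this.1
  clear h
  induction b, hab using Nat.le_induction with
  | base => exact ⟨le_rfl, ha⟩
  | succ b hab ih =>
    obtain ⟨hle, hasc⟩ := ih (by omega) fun j haj hjb ↦ hup j haj (by omega)
    have hcov := hup b hab (by omega) hasc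
    exact ⟨hle.trans hcov.le, .inr hcov⟩

theorem disjoint_desc_ascTop (i : ℕ) : Disjoint (C.desc i) (C.ascTop i) := by
  rw [Set.disjoint_left]
  rintro _ ⟨j, hj, -, -, hji, rfl⟩ ⟨⟨a, ha, -, hai, haj⟩, -⟩
  obtain rfl := C.distinct ha hj haj
  omega

variable {C} {d : Q → ℕ}

theorem disjoint_desc_lowerClosure_asc (hd : Antitone d) (hC : IsTight d C.q C.n) {m i : ℕ}
    (hmi : m < i) : Disjoint (C.desc i) (lowerClosure (C.asc m)) := by
  rw [Set.disjoint_left]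
  rintro _ ⟨j, hj, -, -, hji, rfl⟩ ⟨_, ⟨a, -, -, ham, rfl⟩, hle⟩
  have hsucc := C.locMaxBefore_succ_le a
  obtain ⟨l, hal, hlj, hl⟩ := C.exists_ascent_of_locMaxBefore_lt (a := a) hj (by omega)
  exact hC.not_le_of_ascent hd hal hlj hj hl hle

theorem isLocMax_of_desc_le_asc (hd : Antitone d) (hC : IsTight d C.q C.n) {a j : ℕ}
    (hj : j ≤ C.n) (haj : C.locMaxBefore a < C.locMaxBefore j) (hle : C.q j ≤ C.q a) :
    C.IsLocMax a := by
  by_contra hm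
  obtain ⟨l, hal, hlj, hl⟩ := C.exists_ascent_of_locMaxBefore_lt (a := a) hj
    (by rwa [C.locMaxBefore_succ_of_not_isLocMax hm])
  exact hC.not_le_of_ascent hd hal hlj hj hl hle

theorem isGreatest_asc_of_isLocMax {a : ℕ} (ha : a ≤ C.n) (hasc : a = 0 ∨ C.q (a - 1) ⋖ C.q a)
    (hm : C.IsLocMax a) : IsGreatest (C.asc (C.locMaxBefore a + 1)) (C.q a) := by
  refine ⟨⟨a, ha, hasc, rfl, rfl⟩, ?_⟩
  rintro _ ⟨b, -, hb, hbm, rfl⟩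
  have hba : b ≤ a := by
    by_contra! hab
    have := C.locMaxBefore_lt_of_isLocMax hm hab
    omega
  exact C.le_of_locMaxBefore_eq hba ha hb (by omega)

theorem disjoint_desc_lowerClosure_asc_diff_ascTop (hd : Antitone d) (hC : IsTight d C.q C.n)
    (i : ℕ) : Disjoint (C.desc i) (lowerClosure (C.asc i \ C.ascTop i)) := by
  rw [Set.disjoint_left]
  rintro _ ⟨j, hj, -, -, rfl, rfl⟩ ⟨_, ⟨⟨a, ha, hasc, haj, rfl⟩, hnot⟩, hle⟩
  have hm := isLocMax_of_desc_le_asc hd hC hj (by omega) hle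
  exact hnot (haj ▸ isGreatest_asc_of_isLocMax ha hasc hm)

theorem disjoint_asc_lowerClosure_asc (hd : Antitone d) (hC : IsTight d C.q C.n) {m i : ℕ}
    (hmi : m < i) : Disjoint (C.asc i) (lowerClosure (C.asc m)) := by
  rw [Set.disjoint_left]
  rintro _ ⟨j, hj, hasc, hji, rfl⟩ ⟨_, ⟨a, -, -, ham, rfl⟩, hle⟩
  have haj : a < j := C.lt_of_locMaxBefore_lt (by omega)
  refine hC.not_le_of_ascent hd (i := j - 1) (by omega) (by omega) hj ?_ hle
  rw [Nat.sub_add_cancel (by omega)]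
  exact hasc.resolve_left (by omega)

theorem satisfiesStar_of_isTight (hd : Antitone d) (hC : IsTight d C.q C.n) :
    C.SatisfiesStar := by
  intro i _ _
  refine ⟨Disjoint.union_right (Disjoint.union_right ?_
    (disjoint_desc_lowerClosure_asc_diff_ascTop hd hC i)) (C.disjoint_desc_ascTop i), ?_⟩
  · exact Set.disjoint_iUnion₂_right.2 fun m hm ↦ disjoint_desc_lowerClosure_asc hd hC hm.2
  · exact Set.disjoint_iUnion₂_right.2 fun m hm ↦
      disjoint_asc_lowerClosure_asc hd hC (Nat.lt_succ_of_le hm.2)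

end HassePath

/-! ### The lower rank as a least number of ascents -/

section Walk

variable {Q : Type*} [PartialOrder Q]

/-- `HasseWalk x c`: in the Hasse diagram there is a walk, possibly with repeated vertices, from `x`
to a maximal element with exactly `c` ascending edges. -/
inductive HasseWalk : Q → ℕ → Prop
  | of_isMax {x : Q} (hx : IsMax x) : HasseWalk x 0
  | up {x y : Q} {c : ℕ} (hxy : x ⋖ y) (hy : HasseWalk y c) : HasseWalk x (c + 1)
  | down {x y : Q} {c : ℕ} (hyx : y ⋖ x) (hy : HasseWalk y c) : HasseWalk x c

/-- The least number of ascending edges of a walk in the Hasse diagram from `x` to a maximal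
element (`0` if there is no such walk). -/
noncomputable def ascentDist (x : Q) : ℕ := sInf {c | HasseWalk x c}

theorem HasseWalk.ascentDist_le {x : Q} {c : ℕ} (h : HasseWalk x c) : ascentDist x ≤ c :=
  Nat.sInf_le h

theorem HasseWalk.le_mul {v : Q → ℕ} {b : ℕ} (hmax : ∀ x, IsMax x → v x = 0) (hanti : Antitone v)
    (hdrop : ∀ x y, x ⋖ y → v x ≤ v y + b) {x : Q} {c : ℕ} (h : HasseWalk x c) : v x ≤ c * b := by
  induction h with
  | of_isMax hx => exact (hmax _ hx).trans_le (Nat.zero_le _)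
  | up hxy _ ih => exact (hdrop _ _ hxy).trans (by rw [Nat.succ_mul]; omega)
  | down hyx _ ih => exact (hanti hyx.le).trans ih

theorem ascentDist_eq_zero_of_isMax {x : Q} (hx : IsMax x) : ascentDist x = 0 :=
  Nat.le_zero.1 (HasseWalk.of_isMax hx).ascentDist_le

variable [Finite Q]

theorem exists_hasseWalk (x : Q) : ∃ c, HasseWalk x c := by
  induction x using WellFoundedGT.induction with
  | ind x ih =>
    by_cases hx : IsMax x
    · exact ⟨0, .of_isMax hx⟩
    · obtain ⟨y, hxy⟩ := exists_covBy_of_wellFoundedLT hx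
      obtain ⟨c, hc⟩ := ih y hxy.lt
      exact ⟨c + 1, .up hxy hc⟩

theorem hasseWalk_ascentDist (x : Q) : HasseWalk x (ascentDist x) :=
  Nat.sInf_mem (exists_hasseWalk x)

theorem le_ascentDist_mul {v : Q → ℕ} {b : ℕ} (hmax : ∀ x, IsMax x → v x = 0) (hanti : Antitone v)
    (hdrop : ∀ x y, x ⋖ y → v x ≤ v y + b) (x : Q) : v x ≤ ascentDist x * b :=
  (hasseWalk_ascentDist x).le_mul hmax hanti hdrop

theorem ascentDist_le_add_one_of_covBy {x y : Q} (hxy : x ⋖ y) :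
    ascentDist x ≤ ascentDist y + 1 :=
  (HasseWalk.up hxy (hasseWalk_ascentDist y)).ascentDist_le

theorem ascentDist_antitone : Antitone (ascentDist : Q → ℕ) :=
  antitone_of_forall_covBy fun x _ hxy ↦ (HasseWalk.down hxy (hasseWalk_ascentDist x)).ascentDist_le

theorem exists_tightStep_ascentDist {x : Q} (hx : ¬ IsMax x) : ∃ y, TightStep ascentDist x y := by
  generalize hc : ascentDist x = c
  cases hc ▸ hasseWalk_ascentDist x with
  | of_isMax hx' => exact absurd hx' hx
  | up hxy hy =>
    have := ascentDist_le_add_one_of_covBy hxy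
    have := hy.ascentDist_le
    exact ⟨_, .inl ⟨hxy, by omega⟩⟩
  | down hyx hy =>
    exact ⟨_, .inr ⟨hyx, (ascentDist_antitone hyx.le).antisymm (hc ▸ hy.ascentDist_le)⟩⟩

theorem exists_isTight_ascentDist (x : Q) :
    ∃ (q : ℕ → Q) (n : ℕ), q 0 = x ∧ IsMax (q n) ∧ IsTight ascentDist q n := by
  -- A tight step lowers `ascentDist`, or preserves it and moves down in `Q`.
  induction h : toLex (ascentDist x, x) using WellFoundedLT.induction generalizing x with
  | ind _ ih =>
    subst h
    by_cases hx : IsMax x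
    · exact ⟨fun _ ↦ x, 0, rfl, hx, fun i hi ↦ absurd hi i.not_lt_zero⟩
    obtain ⟨y, hxy⟩ := exists_tightStep_ascentDist hx
    have hlt : toLex (ascentDist y, y) < toLex (ascentDist x, x) := by
      rw [Prod.Lex.toLex_lt_toLex]
      rcases hxy with ⟨-, h⟩ | ⟨hyx, h⟩
      · exact .inl (by simp only; omega)
      · exact .inr ⟨h.symm, hyx.lt⟩
    obtain ⟨q, n, rfl, hn, hq⟩ := ih _ hlt y rfl
    refine ⟨fun i ↦ Nat.casesOn i x q, n + 1, rfl, hn, fun i hi ↦ ?_⟩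
    cases i with
    | zero => exact hxy
    | succ i => exact hq i (by omega)

end Walk

section LowerRank

variable {Q : Type*} [PartialOrder Q] [Finite Q]

theorem HassePath.ascentDist_le_upperLength {C : HassePath Q} (hC : C.IsMaximalPath) :
    ascentDist (C.q 0) ≤ C.upperLength := by
  classical
  suffices ∀ i ≤ C.n, ascentDist (C.q 0) ≤
      ascentDist (C.q i) + Nat.count (fun i ↦ C.q i ⋖ C.q (i + 1)) i by
    simpa [C.upperLength_eq_count, ascentDist_eq_zero_of_isMax hC] using this C.n le_rfl
  intro i
  induction i with
  | zero => simp
  | succ i ih =>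
    intro hi
    refine (ih (by omega)).trans ?_
    rw [Nat.count_succ]
    rcases C.step i hi with hup | hdown
    · have := ascentDist_le_add_one_of_covBy hup
      rw [if_pos hup]
      omega
    · have := ascentDist_antitone hdown.le
      omega

theorem lowerRank_le_ascentDist {x : Q} (hx : IsMin x) : lowerRank Q ≤ ascentDist x := by
  classical
  obtain ⟨q, n, rfl, hmax, hq⟩ := exists_isTight_ascentDist x
  let C : HassePath Q :=
    { n := n
      q := q
      distinct := hq.injOn
      isMin_first := hx
      last_ascends := fun i hi ↦ by
        subst hi
        exact (hq i (by omega)).covBy_or_covBy.resolve_right fun h ↦ hmax.not_lt h.lt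
      step := fun i hi ↦ (hq i hi).covBy_or_covBy }
  refine sInf_le ⟨C, hmax, C.satisfiesStar_of_isTight ascentDist_antitone hq, ?_⟩
  rw [hq.eq_add_count, ascentDist_eq_zero_of_isMax hmax, zero_add, C.upperLength_eq_count]

theorem exists_isMin_lowerRank_eq_ascentDist [Nonempty Q] :
    ∃ x : Q, IsMin x ∧ lowerRank Q = ascentDist x := by
  have hne : {x : Q | IsMin x}.Nonempty := by
    obtain ⟨x, hx⟩ := (Set.finite_univ (α := Q)).exists_minimal Set.univ_nonempty
    exact ⟨x, fun y hy ↦ hx.le_of_le trivial hy⟩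
  obtain ⟨x, hx, hmin⟩ := Set.exists_min_image {x : Q | IsMin x} ascentDist (Set.toFinite _) hne
  refine ⟨x, hx, (lowerRank_le_ascentDist hx).antisymm (le_sInf ?_)⟩
  rintro _ ⟨C, hC, -, rfl⟩
  exact_mod_cast (hmin _ C.isMin_first).trans (C.ascentDist_le_upperLength hC)

theorem lowerRank_eq_ascentDist_bot [OrderBot Q] : lowerRank Q = ascentDist (⊥ : Q) := by
  obtain ⟨x, hx, h⟩ := exists_isMin_lowerRank_eq_ascentDist (Q := Q)
  rw [h, hx.eq_bot]

end LowerRank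

section ExtendedPoset

variable {P : Type*} [PartialOrder P]

theorem antitone_extendedPoset_iff {β : Type*} [Preorder β] {f : ExtendedPoset P → β} :
    Antitone f ↔ (∀ a : P, f a ≤ f ⊥) ∧ (∀ a b : P, a ≤ b → f b ≤ f a) ∧
      (∀ a : P, f ⊤ ≤ f a) ∧ f ⊤ ≤ f ⊥ := by
  refine ⟨fun h ↦ ⟨fun a ↦ h bot_le, fun a b hab ↦ h (WithBotTop.coe_le_coe.2 hab),
    fun a ↦ h le_top, h bot_le⟩, fun ⟨hbot, hcoe, htop, hbt⟩ x y hxy ↦ ?_⟩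
  induction x using WithBotTop.rec <;> induction y using WithBotTop.rec
  all_goals simp_all

theorem bot_covBy_coe_iff {a : P} : (⊥ : ExtendedPoset P) ⋖ (a : ExtendedPoset P) ↔ IsMin a :=
  WithBot.bot_covBy_coe.trans ⟨fun h b hb ↦ WithTop.coe_le_coe.1 (h (WithTop.coe_le_coe.2 hb)),
    fun h b hb ↦ by
      obtain ⟨b, rfl, hba⟩ := WithTop.le_coe_iff.1 hb
      exact WithTop.coe_le_coe.2 (h hba)⟩

theorem coe_covBy_top_iff {a : P} : (a : ExtendedPoset P) ⋖ ⊤ ↔ IsMax a :=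
  WithBot.coe_covBy_coe.trans WithTop.coe_covBy_top

theorem coe_covBy_coe_iff {a b : P} : (a : ExtendedPoset P) ⋖ (b : ExtendedPoset P) ↔ a ⋖ b :=
  WithBot.coe_covBy_coe.trans WithTop.coe_covBy_coe

@[elab_as_elim]
theorem covBy_extendedPoset_induction [Nonempty P]
    {motive : (x y : ExtendedPoset P) → x ⋖ y → Prop}
    (bot : ∀ (a : P) (h : ⊥ ⋖ (a : ExtendedPoset P)), IsMin a → motive ⊥ a h)
    (coe : ∀ (a b : P) (h : (a : ExtendedPoset P) ⋖ b), a ⋖ b → motive a b h)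
    (top : ∀ (a : P) (h : (a : ExtendedPoset P) ⋖ ⊤), IsMax a → motive a ⊤ h)
    {x y : ExtendedPoset P} (h : x ⋖ y) : motive x y h := by
  induction x using WithBotTop.rec with
  | top => exact absurd h.lt not_top_lt
  | bot =>
    induction y using WithBotTop.rec with
    | bot => exact absurd h.lt (lt_irrefl _)
    | coe b => exact bot b h (bot_covBy_coe_iff.1 h)
    | top =>
      exact (h.2 (WithBot.bot_lt_coe _)
        (WithBot.coe_lt_coe.2 (WithTop.coe_lt_top (Classical.arbitrary P)))).elim
  | coe a =>
    induction y using WithBotTop.rec with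
    | bot => exact absurd h.lt not_lt_bot
    | coe b => exact coe a b h (coe_covBy_coe_iff.1 h)
    | top => exact top a h (coe_covBy_top_iff.1 h)

theorem HasseWalk.coe_extendedPoset {x : P} {c : ℕ} (h : HasseWalk x c) :
    HasseWalk (x : ExtendedPoset P) (c + 1) := by
  induction h with
  | of_isMax hx => exact .up (coe_covBy_top_iff.2 hx) (.of_isMax isMax_top)
  | up hxy _ ih => exact .up (coe_covBy_coe_iff.2 hxy) ih
  | down hyx _ ih => exact .down (coe_covBy_coe_iff.2 hyx) ih

variable [Finite P]

theorem ascentDist_bot_le {x : P} (hx : IsMin x) :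
    ascentDist (⊥ : ExtendedPoset P) ≤ ascentDist x + 2 :=
  (HasseWalk.up (bot_covBy_coe_iff.2 hx) (hasseWalk_ascentDist x).coe_extendedPoset).ascentDist_le

theorem le_ascentDist_bot [Nonempty P] {m : ℕ} (hm : ∀ x : P, IsMin x → m ≤ ascentDist x) :
    m + 2 ≤ ascentDist (⊥ : ExtendedPoset P) := by
  let v : ExtendedPoset P → ℕ :=
    WithBotTop.rec (motive := fun _ ↦ ℕ) (m + 2) (fun a ↦ min (ascentDist a) m + 1) 0
  have hbot : v ⊥ = m + 2 := rfl
  have hcoe (a : P) : v a = min (ascentDist a) m + 1 := rfl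
  have htop : v ⊤ = 0 := rfl
  have hcov {x y : ExtendedPoset P} (hxy : x ⋖ y) : v y ≤ v x ∧ v x ≤ v y + 1 := by
    induction hxy using covBy_extendedPoset_induction with
    | bot a _ ha =>
      have := hm a ha
      rw [hbot, hcoe]
      omega
    | coe a b _ hab =>
      have := ascentDist_antitone hab.le
      have := ascentDist_le_add_one_of_covBy hab
      rw [hcoe, hcoe]
      omega
    | top a _ ha =>
      have := ascentDist_eq_zero_of_isMax ha
      rw [hcoe, htop]
      omega
  have hmax (x : ExtendedPoset P) (hx : IsMax x) : v x = 0 := by rw [hx.eq_top, htop]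
  simpa only [hbot, mul_one] using
    le_ascentDist_mul hmax (antitone_of_forall_covBy fun _ _ h ↦ (hcov h).1)
      (fun _ _ h ↦ (hcov h).2) ⊥

theorem lowerRank_extendedPoset [Nonempty P] :
    lowerRank (ExtendedPoset P) = lowerRank P + 2 := by
  obtain ⟨x, hx, hrank⟩ := exists_isMin_lowerRank_eq_ascentDist (Q := P)
  have hmin (y : P) (hy : IsMin y) : ascentDist x ≤ ascentDist y := by
    exact_mod_cast hrank ▸ lowerRank_le_ascentDist hy
  rw [hrank, lowerRank_eq_ascentDist_bot,
    (ascentDist_bot_le hx).antisymm (le_ascentDist_bot hmin)]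
  rfl

end ExtendedPoset

/-! ### Splittings for monomial algebras -/

section Cartier

/-- An `R`-linear map `R^{1/q} → R`, encoded as an additive endomorphism of `R`. -/
def IsCartierMap {R : Type*} [CommRing R] (q : ℕ) (φ : R →+ R) : Prop :=
  ∀ r x, φ (r ^ q * x) = r * φ x

variable (p : ℕ) [Fact p.Prime] (e : ℕ)

theorem rootMapSplits_iff {R : Type*} [CommRing R] [CharP R p] {d : R} :
    RootMapSplits p e d ↔ ∃ φ : R →+ R, IsCartierMap (p ^ e) φ ∧ φ d = 1 := by
  constructor
  · rintro ⟨f, hf⟩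
    refine ⟨f.toAddMonoidHom, f.map_smul, ?_⟩
    have h1 := LinearMap.congr_fun hf 1
    rwa [LinearMap.comp_apply, LinearMap.toSpanSingleton_apply, one_smul] at h1
  · rintro ⟨φ, hφ, hd⟩
    refine ⟨{ toFun := φ, map_add' := φ.map_add, map_smul' := hφ }, LinearMap.ext_ring ?_⟩
    rw [LinearMap.comp_apply, LinearMap.toSpanSingleton_apply, one_smul]
    exact hd

theorem rootMapSplits_of_ne_zero {k : Type*} [Field k] [CharP k p] {d : k} (hd : d ≠ 0) :
    RootMapSplits p e d := by
  refine LinearMap.exists_leftInverse_of_injective _ (LinearMap.ker_eq_bot'.2 fun a ha ↦ ?_)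
  rw [LinearMap.toSpanSingleton_apply, smul_frobeniusRoot] at ha
  exact eq_zero_of_pow_eq_zero ((mul_eq_zero.1 ha).resolve_right hd)

end Cartier

section MonomialAlgebra

open MvPolynomial

variable {σ k : Type*} [CommRing k]

/-- `A` is the algebra `k[M]` spanned by the monomials with exponents in `M`. -/
def IsMonomialAlgebra (A : Subalgebra k (MvPolynomial σ k)) (M : AddSubmonoid (σ →₀ ℕ)) : Prop :=
  ∀ f, f ∈ A ↔ ∀ w ∈ f.support, w ∈ M

/-- For monomials `s` and `n` of `k[M]`, if `n ^ q` divides `s ^ q * x ^ w` in `k[M]`, then `n`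
divides `s`. This turns out to be equivalent to the splitting of `1 ↦ x ^ (w / q)`. -/
def IsSplittingExponent (M : AddSubmonoid (σ →₀ ℕ)) (q : ℕ) (w : σ →₀ ℕ) : Prop :=
  ∀ s ∈ M, ∀ n ∈ M, ∀ u ∈ M, q • s + w = q • n + u → ∃ b ∈ M, s = n + b

open Classical in
/-- The trace map `k[x^{1/q}] → k[M]`, `g^{1/q} ↦ ∑_{v ∈ M} φ (g_{q v + w}) x ^ v`. -/
noncomputable def rootTrace (M : AddSubmonoid (σ →₀ ℕ)) (φ : k →+ k) {q : ℕ} (hq : q ≠ 0)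
    (w : σ →₀ ℕ) : MvPolynomial σ k →+ MvPolynomial σ k where
  toFun g := ⟨(((AddMonoidAlgebra.coeff g).comapDomain (fun v ↦ q • v + w)
    (fun u _ v _ huv ↦ smul_right_injective _ hq (add_right_cancel huv))).mapRange φ
      φ.map_zero).filter (· ∈ M)⟩
  map_zero' := by
    ext v
    exact (congrArg (ite _ · 0) φ.map_zero).trans (ite_self 0)
  map_add' f g := by
    ext v
    change (if v ∈ M then φ (coeff (q • v + w) (f + g)) else 0) =
      (if v ∈ M then φ (coeff (q • v + w) f) else 0) + if v ∈ M then φ (coeff (q • v + w) g) else 0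
    split_ifs
    · exact φ.map_add _ _
    · exact (add_zero 0).symm

variable {M : AddSubmonoid (σ →₀ ℕ)} {A : Subalgebra k (MvPolynomial σ k)} {q : ℕ} {w : σ →₀ ℕ}

theorem IsMonomialAlgebra.monomial_mem (hA : IsMonomialAlgebra A M) (hw : w ∈ M) (c : k) :
    monomial w c ∈ A :=
  (hA _).2 fun _ hv ↦ Finset.mem_singleton.1 (support_monomial_subset hv) ▸ hw

open Classical in
theorem coeff_rootTrace (φ : k →+ k) (hq : q ≠ 0) (v : σ →₀ ℕ) (g : MvPolynomial σ k) :
    coeff v (rootTrace M φ hq w g) = if v ∈ M then φ (coeff (q • v + w) g) else 0 :=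
  rfl

theorem rootTrace_mem (hA : IsMonomialAlgebra A M) (φ : k →+ k) (hq : q ≠ 0)
    (g : MvPolynomial σ k) : rootTrace M φ hq w g ∈ A := by
  classical
  refine (hA _).2 fun v hv ↦ ?_
  by_contra hvM
  exact mem_support_iff.1 hv (by rw [coeff_rootTrace, if_neg hvM])

theorem rootTrace_monomial {φ : k →+ k} (hφ : φ 1 = 1) (hq : q ≠ 0) :
    rootTrace M φ hq w (monomial w 1) = 1 := by
  classical
  ext v
  rw [coeff_rootTrace, coeff_monomial, coeff_one]
  by_cases hv : v = 0
  · rw [if_pos (hv ▸ M.zero_mem), if_pos (by simp [hv]), if_pos hv.symm, hφ]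
  · rw [if_neg (c := w = _) (by simpa [hq] using hv), if_neg (Ne.symm hv), map_zero, ite_self]

theorem rootTrace_monomial_mul {φ : k →+ k} (hφ : IsCartierMap q φ) (hq : q ≠ 0)
    (hw : IsSplittingExponent M q w) {a : σ →₀ ℕ} (ha : a ∈ M) (c : k) {g : MvPolynomial σ k}
    (hg : ∀ u ∈ g.support, u ∈ M) :
    rootTrace M φ hq w (monomial a c ^ q * g) = monomial a c * rootTrace M φ hq w g := by
  classical
  ext v
  rw [coeff_rootTrace, monomial_pow, coeff_monomial_mul', coeff_monomial_mul', coeff_rootTrace]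
  by_cases hv : ∃ b ∈ M, v = a + b
  · obtain ⟨b, hb, rfl⟩ := hv
    have hexp : q • (a + b) + w = q • a + (q • b + w) := by rw [smul_add, add_assoc]
    rw [if_pos (add_mem ha hb), if_pos (hexp ▸ le_self_add), if_pos le_self_add, hexp,
      add_tsub_cancel_left, add_tsub_cancel_left, if_pos hb, hφ]
  · have hright : ¬ (a ≤ v ∧ v - a ∈ M) := fun h ↦ hv ⟨_, h.2, (add_tsub_cancel_of_le h.1).symm⟩
    have hleft (hvM : v ∈ M) (hle : q • a ≤ q • v + w) :
        coeff (q • v + w - q • a) g = 0 := by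
      by_contra hne
      exact hv (hw v hvM a ha _ (hg _ (mem_support_iff.2 hne)) (add_tsub_cancel_of_le hle).symm)
    trans 0
    · split_ifs with hvM hle
      · rw [hleft hvM hle, mul_zero, map_zero]
      · exact map_zero φ
      · rfl
    · split_ifs with hle hM
      · exact absurd ⟨hle, hM⟩ hright
      · exact (mul_zero c).symm
      · rfl

variable {p : ℕ} [Fact p.Prime] {e : ℕ}

theorem rootTrace_pow_mul [CharP k p] {φ : k →+ k} (hφ : IsCartierMap (p ^ e) φ) (hq : p ^ e ≠ 0)
    (hw : IsSplittingExponent M (p ^ e) w) {r g : MvPolynomial σ k}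
    (hr : ∀ u ∈ r.support, u ∈ M) (hg : ∀ u ∈ g.support, u ∈ M) :
    rootTrace M φ hq w (r ^ p ^ e * g) = r * rootTrace M φ hq w g := by
  rw [← r.support_sum_monomial_coeff, sum_pow_char_pow, Finset.sum_mul, map_sum, Finset.sum_mul]
  exact Finset.sum_congr rfl fun a ha ↦ rootTrace_monomial_mul hφ hq hw (hr a ha) _ hg

variable [CharP A p] {d : A}

theorem rootMapSplits_of_isSplittingExponent [CharP k p] (hk : RootMapSplits p e (1 : k))
    (hA : IsMonomialAlgebra A M) (hw : IsSplittingExponent M (p ^ e) w)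
    (hd : (d : MvPolynomial σ k) = monomial w 1) : RootMapSplits p e d := by
  obtain ⟨φ, hφ, hφ1⟩ := (rootMapSplits_iff p e).1 hk
  have hq : p ^ e ≠ 0 := pow_ne_zero _ (Fact.out : p.Prime).ne_zero
  let ψ : A →+ A := .mk' (fun g ↦ ⟨rootTrace M φ hq w g, rootTrace_mem hA φ hq g⟩)
    fun g h ↦ Subtype.ext (map_add (rootTrace M φ hq w) g.1 h.1)
  refine (rootMapSplits_iff p e).2 ⟨ψ, fun r g ↦ Subtype.ext ?_, Subtype.ext ?_⟩
  · exact rootTrace_pow_mul hφ hq hw ((hA _).1 r.2) ((hA _).1 g.2)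
  · exact (congrArg _ hd).trans (rootTrace_monomial hφ1 hq)

theorem coeff_zero_eq_zero_of_isCartierMap (hA : IsMonomialAlgebra A M) {φ : A →+ A}
    (hφ : IsCartierMap q φ) {s n u : σ →₀ ℕ} (hw : w ∈ M) (hs : s ∈ M) (hn : n ∈ M) (hu : u ∈ M)
    (h : q • s + w = q • n + u) (hsn : ¬ ∃ b ∈ M, s = n + b) (c : k) :
    coeff 0 (φ ⟨monomial w c, hA.monomial_mem hw c⟩ : MvPolynomial σ k) = 0 := by
  classical
  let x {v : σ →₀ ℕ} (hv : v ∈ M) (c : k) : A := ⟨monomial v c, hA.monomial_mem hv c⟩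
  have hmul : x hs 1 ^ q * x hw c = x hn 1 ^ q * x hu c := Subtype.ext <| by
    simp only [x, MulMemClass.coe_mul, SubmonoidClass.coe_pow, monomial_pow, monomial_mul, h]
  have himage : monomial s 1 * (φ (x hw c)).1 = monomial n 1 * (φ (x hu c)).1 :=
    congrArg Subtype.val <| show x hs 1 * φ (x hw c) = x hn 1 * φ (x hu c) by
      rw [← hφ, ← hφ, hmul]
  have hcoeff := congrArg (coeff s) himage
  rw [coeff_monomial_mul', if_pos le_rfl, tsub_self, one_mul, coeff_monomial_mul', one_mul]
    at hcoeff
  rw [hcoeff, ite_eq_right_iff]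
  intro hns
  by_contra hne
  exact hsn ⟨s - n, (hA _).1 (φ (x hu c)).2 _ (mem_support_iff.2 hne),
    (add_tsub_cancel_of_le hns).symm⟩

theorem exists_isSplittingExponent_of_rootMapSplits [Nontrivial k] (hA : IsMonomialAlgebra A M)
    (hd : RootMapSplits p e d) :
    ∃ w ∈ (d : MvPolynomial σ k).support, IsSplittingExponent M (p ^ e) w := by
  obtain ⟨φ, hφ, hφd⟩ := (rootMapSplits_iff p e).1 hd
  by_contra! hne
  have hM := (hA _).1 d.2
  have hsum : d = ∑ w ∈ (d : MvPolynomial σ k).support.attach,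
      ⟨monomial w.1 (coeff w.1 (d : MvPolynomial σ k)), hA.monomial_mem (hM w.1 w.2) _⟩ :=
    Subtype.ext <| by
      rw [AddSubmonoidClass.coe_finsetSum, Finset.sum_attach _ (fun w ↦
        monomial w (coeff w (d : MvPolynomial σ k))), support_sum_monomial_coeff]
  have hzero : coeff 0 (φ d : MvPolynomial σ k) = 0 := by
    rw [hsum, map_sum, AddSubmonoidClass.coe_finsetSum, coeff_sum]
    refine Finset.sum_eq_zero fun w _ ↦ ?_
    have := hne w.1 w.2
    unfold IsSplittingExponent at this
    push Not at this
    obtain ⟨s, hs, n, hn, u, hu, h, hsn⟩ := this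
    exact coeff_zero_eq_zero_of_isCartierMap hA hφ (hM w.1 w.2) hs hn hu h (by simpa using hsn) _
  rw [hφd] at hzero
  exact one_ne_zero (coeff_zero_one.symm.trans hzero)

end MonomialAlgebra

/-! ### The monoid of exponents of the Hibi ring -/

section HibiMonoid

variable {P : Type*}

/-- The exponent vector of a monomial as a function on the extended poset: the exponent of `T` is
the value at the least element, and the value at the greatest element is zero. -/
def extendedExponent : (Option P →₀ ℕ) →+ (ExtendedPoset P → ℕ) where
  toFun w := WithBotTop.rec (motive := fun _ ↦ ℕ) (w none) (fun a ↦ w (some a)) 0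
  map_zero' := by
    funext x
    induction x using WithBotTop.rec <;> rfl
  map_add' v w := by
    funext x
    induction x using WithBotTop.rec <;> rfl

@[simp]
theorem extendedExponent_bot (w : Option P →₀ ℕ) : extendedExponent w ⊥ = w none := rfl

@[simp]
theorem extendedExponent_coe (w : Option P →₀ ℕ) (a : P) :
    extendedExponent w (a : ExtendedPoset P) = w (some a) := rfl

@[simp]
theorem extendedExponent_top (w : Option P →₀ ℕ) : extendedExponent w ⊤ = 0 := rfl

theorem extendedExponent_injective :
    Function.Injective (extendedExponent : (Option P →₀ ℕ) →+ (ExtendedPoset P → ℕ)) := by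
  intro v w h
  ext o
  rcases o with _ | a
  · exact congrFun h ⊥
  · exact congrFun h (a : ExtendedPoset P)

theorem smul_add_eq_smul_add_iff_extendedExponent {q : ℕ} {s n u w : Option P →₀ ℕ} :
    q • s + w = q • n + u ↔ ∀ x, (q : ℤ) * extendedExponent s x + extendedExponent w x =
      q * extendedExponent n x + extendedExponent u x := by
  rw [← extendedExponent_injective.eq_iff, funext_iff]
  refine forall_congr' fun x ↦ ?_
  rw [map_add, map_add, map_nsmul, map_nsmul, Pi.add_apply, Pi.add_apply, Pi.smul_apply,
    Pi.smul_apply, smul_eq_mul, smul_eq_mul, ← Int.natCast_inj]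
  push_cast
  rfl

variable [PartialOrder P]

variable (P) in
/-- The exponent vectors of the monomials of the Hibi ring. -/
def hibiMonoid : AddSubmonoid (Option P →₀ ℕ) where
  carrier := {w | Antitone (extendedExponent w)}
  zero_mem' := by
    change Antitone (extendedExponent 0)
    rw [map_zero]
    exact antitone_const
  add_mem' hv hw := by
    change Antitone (extendedExponent (_ + _))
    rw [map_add]
    exact hv.add hw

theorem mem_hibiMonoid {w : Option P →₀ ℕ} : w ∈ hibiMonoid P ↔ Antitone (extendedExponent w) :=
  Iff.rfl

theorem mem_hibiMonoid_iff {w : Option P →₀ ℕ} : w ∈ hibiMonoid P ↔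
    (∀ a, w (some a) ≤ w none) ∧ ∀ a b, a ≤ b → w (some b) ≤ w (some a) := by
  rw [mem_hibiMonoid, antitone_extendedPoset_iff]
  simp

section OfAntitone

variable [Finite P]

/-- The exponent vector given by a function `z` on the extended poset, normalized to have value zero
at the greatest element. Negative values are truncated; for antitone `z` there are none. -/
noncomputable def exponentOf (z : ExtendedPoset P → ℤ) : Option P →₀ ℕ :=
  Finsupp.equivFunOnFinite.symm fun o ↦ (z (o.elim ⊥ fun a ↦ (a : ExtendedPoset P)) - z ⊤).toNat

variable {z : ExtendedPoset P → ℤ}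

theorem extendedExponent_exponentOf (hz : Antitone z) (x : ExtendedPoset P) :
    (extendedExponent (exponentOf z) x : ℤ) = z x - z ⊤ := by
  have hnonneg : 0 ≤ z x - z ⊤ := sub_nonneg.2 (hz le_top)
  induction x using WithBotTop.rec with
  | bot => exact Int.toNat_of_nonneg hnonneg
  | coe a => exact Int.toNat_of_nonneg hnonneg
  | top => exact (sub_self _).symm

theorem exponentOf_mem_hibiMonoid (hz : Antitone z) : exponentOf z ∈ hibiMonoid P := by
  intro x y hxy
  rw [← Int.ofNat_le, extendedExponent_exponentOf hz, extendedExponent_exponentOf hz]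
  exact sub_le_sub_right (hz hxy) _

end OfAntitone

/-! ### Splitting exponents of the Hibi ring -/

theorem isSplittingExponent_hibiMonoid_of_lt [Finite P] {q : ℕ} {w : Option P →₀ ℕ}
    (hw : ∀ x y, x ⋖ y → extendedExponent w x < extendedExponent w y + q) :
    IsSplittingExponent (hibiMonoid P) q w := by
  intro s _ n _ u hu h
  rw [smul_add_eq_smul_add_iff_extendedExponent] at h
  let z (x : ExtendedPoset P) : ℤ := extendedExponent s x - extendedExponent n x
  have hz : Antitone z := antitone_of_forall_covBy fun x y hxy ↦ by
    have hux : (extendedExponent u y : ℤ) ≤ extendedExponent u x := by exact_mod_cast hu hxy.le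
    have hwx : (extendedExponent w x : ℤ) < extendedExponent w y + q := by exact_mod_cast hw x y hxy
    have hx := h x
    have hy := h y
    refine Int.le_of_lt_add_one (lt_of_mul_lt_mul_left ?_ q.cast_nonneg)
    simp only [z, mul_sub, mul_add]
    linarith
  have hb (x : ExtendedPoset P) : (extendedExponent (exponentOf z) x : ℤ) =
      extendedExponent s x - extendedExponent n x := by
    rw [extendedExponent_exponentOf hz]
    exact sub_zero _
  refine ⟨exponentOf z, exponentOf_mem_hibiMonoid hz, extendedExponent_injective ?_⟩
  funext x
  rw [map_add, Pi.add_apply, ← Int.natCast_inj, Nat.cast_add, hb, add_sub_cancel]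

open Classical in
theorem antitone_ite_mem_lowerSet {α : Type*} [Preorder α] (I : LowerSet α) :
    Antitone fun a ↦ if a ∈ I then (1 : ℤ) else 0 := by
  intro a b hab
  by_cases hb : b ∈ I
  · exact (if_pos hb).trans_le (if_pos (I.lower hab hb)).ge
  · simp only [if_neg hb]
    split_ifs <;> simp

theorem exists_sub_antitone_of_covBy {α : Type*} [PartialOrder α] {x y : α} (hxy : x ⋖ y) :
    ∃ s n : α → ℤ, Antitone s ∧ Antitone n ∧ s y - n y = s x - n x + 1 ∧
      ∀ a b, a ⋖ b → ¬ (a = x ∧ b = y) → s b - n b ≤ s a - n a := by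
  classical
  let ind (I : LowerSet α) (a : α) : ℤ := if a ∈ I then 1 else 0
  -- The difference is the indicator function of `{a | a ≤ y ∧ a ≠ x}`.
  have hdiff (a : α) : ind (.Iio x) a + ind (.Iic y) a - ind (.Iic x) a =
      if a ≤ y ∧ a ≠ x then 1 else 0 := by
    simp only [ind, LowerSet.mem_Iio_iff, LowerSet.mem_Iic_iff]
    have hle : a ≤ x → a ≤ y := (·.trans hxy.le)
    have hlt : a < x ↔ a ≤ x ∧ a ≠ x := lt_iff_le_and_ne
    have hxx : a = x → a ≤ x := le_of_eq
    grind
  refine ⟨fun a ↦ ind (.Iio x) a + ind (.Iic y) a, ind (.Iic x),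
    (antitone_ite_mem_lowerSet _).add (antitone_ite_mem_lowerSet _), antitone_ite_mem_lowerSet _,
    ?_, fun a b hab hne ↦ ?_⟩
  · simp only [hdiff]
    rw [if_pos ⟨le_rfl, hxy.ne'⟩, if_neg fun h ↦ h.2 rfl, zero_add]
  · simp only [hdiff]
    by_cases hb : b ≤ y ∧ b ≠ x
    · have hax : a ≠ x := by
        rintro rfl
        exact hne ⟨rfl, (hxy.eq_or_eq hab.le hb.1).resolve_left hab.ne'⟩
      rw [if_pos hb, if_pos ⟨hab.le.trans hb.1, hax⟩]
    · rw [if_neg hb]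
      split_ifs <;> simp

theorem IsSplittingExponent.lt_of_covBy [Finite P] {q : ℕ} {w : Option P →₀ ℕ}
    (hw : w ∈ hibiMonoid P) (h : IsSplittingExponent (hibiMonoid P) q w) {x y : ExtendedPoset P}
    (hxy : x ⋖ y) : extendedExponent w x < extendedExponent w y + q := by
  by_contra! hdrop
  obtain ⟨s, n, hs, hn, hsn, hsn'⟩ := exists_sub_antitone_of_covBy hxy
  let u (a : ExtendedPoset P) : ℤ := q * (s a - n a) + extendedExponent w a
  have hu : Antitone u := antitone_of_forall_covBy fun a b hab ↦ by
    simp only [u]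
    by_cases hne : a = x ∧ b = y
    · obtain ⟨rfl, rfl⟩ := hne
      have : (extendedExponent w b : ℤ) + q ≤ extendedExponent w a := by exact_mod_cast hdrop
      rw [hsn]
      linarith
    · have : (extendedExponent w b : ℤ) ≤ extendedExponent w a := by exact_mod_cast hw hab.le
      exact add_le_add (mul_le_mul_of_nonneg_left (hsn' a b hab hne) q.cast_nonneg) this
  have heq : q • exponentOf s + w = q • exponentOf n + exponentOf u :=
    smul_add_eq_smul_add_iff_extendedExponent.2 fun a ↦ by
      rw [extendedExponent_exponentOf hs, extendedExponent_exponentOf hn,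
        extendedExponent_exponentOf hu]
      simp only [u, extendedExponent_top]
      ring
  obtain ⟨b, hb, hsnb⟩ := h _ (exponentOf_mem_hibiMonoid hs) _ (exponentOf_mem_hibiMonoid hn) _
    (exponentOf_mem_hibiMonoid hu) heq
  have hval (a : ExtendedPoset P) : s a - s ⊤ = n a - n ⊤ + extendedExponent b a := by
    rw [← extendedExponent_exponentOf hs, ← extendedExponent_exponentOf hn, hsnb, map_add]
    exact Nat.cast_add _ _
  have hx := hval x
  have hy := hval y
  have := hb hxy.le
  omega

end HibiMonoid

/-! ### The Hibi ring as a monomial algebra -/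

section HibiRing

open MvPolynomial

theorem isMonomialAlgebra_adjoin {σ : Type*} (k : Type*) [CommRing k] (S : Set (σ →₀ ℕ)) :
    IsMonomialAlgebra (Algebra.adjoin k ((fun w ↦ monomial w (1 : k)) '' S))
      (AddSubmonoid.closure S) := by
  classical
  refine fun f ↦ ⟨fun hf ↦ ?_, fun hf ↦ ?_⟩
  · induction hf using Algebra.adjoin_induction with
    | mem f hf =>
      obtain ⟨v, hv, rfl⟩ := hf
      intro w hw
      rw [Finset.mem_singleton.1 (support_monomial_subset hw)]
      exact AddSubmonoid.subset_closure hv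
    | algebraMap c =>
      intro w hw
      rw [Finset.mem_singleton.1 (support_monomial_subset hw)]
      exact zero_mem _
    | add f g _ _ hf hg =>
      exact fun w hw ↦ (Finset.mem_union.1 (support_add hw)).elim (hf w) (hg w)
    | mul f g _ _ hf hg =>
      intro w hw
      obtain ⟨u, hu, v, hv, rfl⟩ := Finset.mem_add.1 (support_mul f g hw)
      exact add_mem (hf u hu) (hg v hv)
  · have hmon (w : σ →₀ ℕ) (hw : w ∈ AddSubmonoid.closure S) :
        monomial w (1 : k) ∈ Algebra.adjoin k ((fun w ↦ monomial w (1 : k)) '' S) := by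
      induction hw using AddSubmonoid.closure_induction with
      | mem w hw => exact Algebra.subset_adjoin ⟨w, hw, rfl⟩
      | zero => exact one_mem _
      | add u v _ _ hu hv =>
        have := mul_mem hu hv
        rwa [monomial_mul, mul_one] at this
    rw [← f.support_sum_monomial_coeff]
    refine sum_mem fun w hw ↦ ?_
    rw [← mul_one (coeff w f), ← smul_eq_mul, ← smul_monomial]
    exact Subalgebra.smul_mem _ (hmon w (hf w hw)) _

variable {P : Type*} [PartialOrder P] [Fintype P]

open Classical in
/-- The exponent vector of the generator of the Hibi ring given by a poset ideal. -/
noncomputable def idealExponent (I : LowerSet P) : Option P →₀ ℕ :=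
  Finsupp.equivFunOnFinite.symm fun o ↦ o.elim 1 fun a ↦ if a ∈ I then 1 else 0

@[simp]
theorem idealExponent_none (I : LowerSet P) : idealExponent I none = 1 := rfl

open Classical in
@[simp]
theorem idealExponent_some (I : LowerSet P) (a : P) :
    idealExponent I (some a) = if a ∈ I then 1 else 0 := rfl

theorem idealExponent_mem_hibiMonoid (I : LowerSet P) : idealExponent I ∈ hibiMonoid P := by
  classical
  refine mem_hibiMonoid_iff.2 ⟨fun a ↦ ?_, fun a b hab ↦ ?_⟩
  · rw [idealExponent_some, idealExponent_none]
    split_ifs <;> simp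
  · rw [idealExponent_some, idealExponent_some]
    by_cases hb : b ∈ I
    · rw [if_pos hb, if_pos (show a ∈ I from I.lower hab hb)]
    · rw [if_neg hb]
      exact Nat.zero_le _

theorem exists_eq_idealExponent_add {w : Option P →₀ ℕ} (hw : w ∈ hibiMonoid P)
    (hpos : w none ≠ 0) :
    ∃ (I : LowerSet P), ∃ v ∈ hibiMonoid P, w = idealExponent I + v ∧ v none < w none := by
  classical
  obtain ⟨hnone, hsome⟩ := mem_hibiMonoid_iff.1 hw
  let I : LowerSet P := ⟨{a | 0 < w (some a)}, fun a b hba ha ↦ ha.trans_le (hsome b a hba)⟩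
  have hI (a : P) : a ∈ I ↔ 0 < w (some a) := Iff.rfl
  refine ⟨I, w.mapRange (· - 1) rfl, mem_hibiMonoid_iff.2 ⟨fun a ↦ ?_, fun a b hab ↦ ?_⟩, ?_, ?_⟩
  · exact Nat.sub_le_sub_right (hnone a) 1
  · exact Nat.sub_le_sub_right (hsome a b hab) 1
  · ext (_ | a)
    · simp only [Finsupp.add_apply, idealExponent_none, Finsupp.mapRange_apply]
      omega
    · simp only [Finsupp.add_apply, idealExponent_some, Finsupp.mapRange_apply, hI]
      split_ifs <;> omega
  · simp only [Finsupp.mapRange_apply]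
    omega

theorem closure_range_idealExponent :
    AddSubmonoid.closure (Set.range (idealExponent (P := P))) = hibiMonoid P := by
  refine le_antisymm (AddSubmonoid.closure_le.2 ?_) fun w hw ↦ ?_
  · rintro _ ⟨I, rfl⟩
    exact idealExponent_mem_hibiMonoid I
  induction h : w none using Nat.strong_induction_on generalizing w with
  | _ N ih =>
    subst h
    by_cases hzero : w none = 0
    · have : w = 0 := by
        ext (_ | a)
        · exact hzero
        · exact Nat.le_zero.1 (hzero ▸ (mem_hibiMonoid_iff.1 hw).1 a)
      exact this ▸ zero_mem _
    · obtain ⟨I, v, hv, rfl, hlt⟩ := exists_eq_idealExponent_add hw hzero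
      exact add_mem (AddSubmonoid.subset_closure ⟨I, rfl⟩) (ih _ hlt v hv rfl)

variable (k : Type*) [Field k]

theorem hibiMonomial_eq_monomial (I : LowerSet P) :
    hibiMonomial k P I = monomial (idealExponent I) 1 := by
  classical
  rw [hibiMonomial, monomial_eq, C_1, one_mul, Finsupp.prod_fintype _ _ (by simp),
    Fintype.prod_option, idealExponent_none, pow_one, Finset.prod_filter]
  congr 1
  refine Finset.prod_congr (by congr) fun a _ ↦ ?_
  rw [idealExponent_some]
  split_ifs <;> simp

theorem isMonomialAlgebra_hibiRing : IsMonomialAlgebra (hibiRing k P) (hibiMonoid P) := by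
  rw [← closure_range_idealExponent, hibiRing, funext (hibiMonomial_eq_monomial k),
    Set.range_comp' (fun w ↦ monomial w (1 : k)) idealExponent]
  exact isMonomialAlgebra_adjoin k _

variable {k}

theorem exists_mem_pow_eq_monomial {w : Option P →₀ ℕ} (hw : w ∈ hibiMonoid P) :
    ∃ r ∈ hibiMaxIdeal k P ^ w none, (r : MvPolynomial (Option P) k) = monomial w 1 := by
  rw [← closure_range_idealExponent] at hw
  induction hw using AddSubmonoid.closure_induction with
  | mem w hw =>
    obtain ⟨I, rfl⟩ := hw
    refine ⟨hibiGen k P I, ?_, hibiMonomial_eq_monomial k I⟩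
    rw [idealExponent_none, pow_one]
    exact Ideal.subset_span ⟨I, rfl⟩
  | zero => exact ⟨1, by simp, rfl⟩
  | add u v _ _ hu hv =>
    obtain ⟨r, hr, hru⟩ := hu
    obtain ⟨s, hs, hsv⟩ := hv
    refine ⟨r * s, ?_, ?_⟩
    · rw [Finsupp.add_apply, pow_add]
      exact Ideal.mul_mem_mul hr hs
    · rw [MulMemClass.coe_mul, hru, hsv, monomial_mul, one_mul]

theorem le_of_mem_hibiMaxIdeal_pow {N : ℕ} {f : hibiRing k P} (hf : f ∈ hibiMaxIdeal k P ^ N)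
    {w : Option P →₀ ℕ} (hw : w ∈ (f : MvPolynomial (Option P) k).support) : N ≤ w none := by
  have hmap : (hibiMaxIdeal k P).map (hibiRing k P).val ≤ Ideal.span {X none} := by
    rw [hibiMaxIdeal, Ideal.map_span, Ideal.span_le]
    rintro _ ⟨_, ⟨I, rfl⟩, rfl⟩
    exact Ideal.mem_span_singleton.2 (Dvd.intro _ rfl)
  have hdvd : (X none) ^ N ∣ (f : MvPolynomial (Option P) k) := by
    rw [← Ideal.mem_span_singleton, ← Ideal.span_singleton_pow]
    refine Ideal.pow_right_mono hmap N ?_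
    rw [← Ideal.map_pow]
    exact Ideal.mem_map_of_mem _ hf
  obtain ⟨g, hg⟩ := hdvd
  rw [mem_support_iff, hg, X_pow_eq_monomial, coeff_monomial_mul'] at hw
  by_contra hlt
  exact hw (if_neg fun hle ↦ hlt (by simpa using hle none))

end HibiRing

/-! ### The F-pure threshold of the Hibi ring -/

section Threshold

variable (p : ℕ) [Fact p.Prime] (k : Type*) [Field k] [CharP k p]
  (P : Type*) [PartialOrder P] [Fintype P]

theorem isFPurePair_ascentDist :
    IsFPurePair p (hibiMaxIdeal k P) (ascentDist (⊥ : ExtendedPoset P) : ℝ≥0) := by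
  refine Filter.Eventually.of_forall fun e ↦ ?_
  have hq : 1 ≤ p ^ e := Nat.one_le_pow _ _ (Fact.out : p.Prime).pos
  let z (x : ExtendedPoset P) : ℤ := ((p ^ e - 1) * ascentDist x : ℕ)
  have hz : Antitone z := fun x y hxy ↦
    Int.ofNat_le.2 (Nat.mul_le_mul_left _ (ascentDist_antitone hxy))
  have hval (x : ExtendedPoset P) :
      extendedExponent (exponentOf z) x = (p ^ e - 1) * ascentDist x := by
    rw [← Int.natCast_inj, extendedExponent_exponentOf hz]
    simp [z, ascentDist_eq_zero_of_isMax isMax_top]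
  obtain ⟨d, hd, hdw⟩ := exists_mem_pow_eq_monomial (k := k) (exponentOf_mem_hibiMonoid hz)
  refine ⟨d, ?_, rootMapSplits_of_isSplittingExponent
    (rootMapSplits_of_ne_zero p e (one_ne_zero' k)) (isMonomialAlgebra_hibiRing k)
    (isSplittingExponent_hibiMonoid_of_lt fun x y hxy ↦ ?_) hdw⟩
  · convert hd
    rw [← extendedExponent_bot, hval, ← Nat.ceil_natCast (R := ℝ) ((p ^ e - 1) * _)]
    push_cast [Nat.cast_sub hq]
    rw [mul_comm]
  · rw [hval, hval]
    have := Nat.mul_le_mul_left (p ^ e - 1) (ascentDist_le_add_one_of_covBy hxy)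
    rw [mul_add, mul_one] at this
    omega

variable {p k P} in
theorem le_ascentDist_of_isFPurePair {t : ℝ≥0} (ht : IsFPurePair p (hibiMaxIdeal k P) t) :
    t ≤ ascentDist (⊥ : ExtendedPoset P) := by
  obtain ⟨e, ⟨d, hd, hsplit⟩, he⟩ := (ht.and (Filter.eventually_ge_atTop 1)).exists
  have hA := isMonomialAlgebra_hibiRing (P := P) k
  obtain ⟨w, hwd, hw⟩ := exists_isSplittingExponent_of_rootMapSplits hA hsplit
  have hwM := (hA _).1 d.2 w hwd
  have hq : 1 < p ^ e := Nat.one_lt_pow (by omega) (Fact.out : p.Prime).one_lt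
  have hdeg : w none ≤ ascentDist (⊥ : ExtendedPoset P) * (p ^ e - 1) :=
    le_ascentDist_mul (fun x hx ↦ by rw [hx.eq_top, extendedExponent_top]) hwM
      (fun x y hxy ↦ by have := hw.lt_of_covBy hwM hxy; omega) ⊥
  have hreal : (t : ℝ) * ((p : ℝ) ^ e - 1) ≤
      ascentDist (⊥ : ExtendedPoset P) * ((p : ℝ) ^ e - 1) := by
    refine (Nat.le_ceil _).trans ?_
    have := Nat.cast_le (α := ℝ).2 ((le_of_mem_hibiMaxIdeal_pow hd hwd).trans hdeg)
    push_cast [Nat.cast_sub hq.le] at this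
    exact this
  have hpos : (0 : ℝ) < (p : ℝ) ^ e - 1 := sub_pos.2 (by exact_mod_cast hq)
  exact_mod_cast le_of_mul_le_mul_right hreal hpos

theorem fpt_hibiMaxIdeal :
    fpt p (hibiMaxIdeal k P) = (ascentDist (⊥ : ExtendedPoset P) : ℝ≥0∞) := by
  refine le_antisymm (sSup_le ?_) (le_sSup ⟨_, isFPurePair_ascentDist p k P, by simp⟩)
  rintro _ ⟨t, ht, rfl⟩
  exact_mod_cast le_ascentDist_of_isFPurePair ht

end Threshold

theorem theorem3p9 (p : ℕ) [Fact p.Prime] (k : Type*) [Field k] [CharP k p]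
    (P : Type*) [PartialOrder P] [Fintype P] :
    fpt p (hibiMaxIdeal k P) = ((lowerRank (ExtendedPoset P) : ℕ∞) : ℝ≥0∞) ∧
    (Nonempty P → lowerRank (ExtendedPoset P) = lowerRank P + 2) ∧
    ∃ n : ℕ, fpt p (hibiMaxIdeal k P) = (n : ℝ≥0∞) := by
  refine ⟨?_, fun _ ↦ lowerRank_extendedPoset, _, fpt_hibiMaxIdeal p k P⟩
  rw [fpt_hibiMaxIdeal, lowerRank_eq_ascentDist_bot, ENat.toENNReal_coe]
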